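/- Let $q_1,\dots,q_k$ be qubits arranged in a line, and consider circuits over the gate set consisting of CNOT gates acting on two neighbouring qubits $q_j,q_{j+1}$ (in either direction), the gates $T=\mathrm{diag}(1,e^{i\pi/4})$ and $T^\dagger$ (each counted as one $T$ gate), the Hadamard gate $H$, and the rotations $R_z(\theta)=\mathrm{diag}(e^{-i\theta/2},e^{i\theta/2})$ with arbitrary real angle $\theta$. Let $n\ge 1$ and $k\ge n+1$, let $q_t$ be any one of the qubits (the target), let $C$ be any set of $n$ of the other qubits (the controls), and let $W\in SU(2)$. The multi-controlled gate with these data is the operator on the $k$ qubits that applies $W$ to $q_t$ if all qubits of $C$ are in the state $|1\rangle$, and the identity otherwise. Then: 1. This gate is implemented exactly, on these $k$ qubits and without any ancilla, by a circuit with at most $4k+8n-14$ CNOT gates, at most $16n-16$ $T$ gates, at most $8n+12$ $H$ gates, and at most $8$ $R_z$ gates. 2. If moreover $n_2=0$, where $n_2$ is the number of controls $q_c\in C$ with $c>t+1$ (in particular, if the target lies below all controls), then it is implemented exactly, without any ancilla, by a circuit with at most $4k+8n-14$ CNOT gates, at most $16n-16$ $T$ gates, at most $8n+12$ $H$ gates,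 and at most $6$ $R_z$ gates. -/

import Mathlib

/-!
Quantum circuits on a line of `k` qubits with nearest-neighbour connectivity (LNN) over the
gate set CNOT, T, H and `R_z`, and multi-controlled single-qubit gates.
-/

namespace LNN

/-- Computational basis labels of `k` qubits: qubit `j` is in the state `x j`. -/
abbrev Basis (k : ℕ) : Type := Fin k → Fin 2

/-- Operators on the state space of `k` qubits, as matrices in the computational basis. -/
abbrev Operator (k : ℕ) : Type := Matrix (Basis k) (Basis k) ℂ

/-- The multi-controlled gate: it applies `U` to the target qubit `t` if all the qubits in `C`
are in the state `1`, and the identity otherwise; all qubits other than `t` keep their value.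
For `C = ∅` this is the gate `U` acting on the qubit `t`. -/
def mcGate {k : ℕ} (C : Finset (Fin k)) (t : Fin k) (U : Matrix (Fin 2) (Fin 2) ℂ) :
    Operator k :=
  fun x y =>
    if ∀ j, j ≠ t → x j = y j then
      (if ∀ c ∈ C, y c = 1 then U (x t) (y t) else (1 : Matrix (Fin 2) (Fin 2) ℂ) (x t) (y t))
    else 0

/-- The Pauli matrix `X`. -/
def matX : Matrix (Fin 2) (Fin 2) ℂ := !![0, 1; 1, 0]

/-- The Hadamard matrix. -/
noncomputable def matH : Matrix (Fin 2) (Fin 2) ℂ :=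
  ((1 / Real.sqrt 2 : ℝ) : ℂ) • !![1, 1; 1, -1]

/-- The matrix of the phase gate `diag(1, e^{iφ})`. -/
noncomputable def matP (φ : ℝ) : Matrix (Fin 2) (Fin 2) ℂ :=
  !![1, 0; 0, Complex.exp (Complex.I * (φ : ℂ))]

/-- The matrix of the rotation `R_z(θ) = diag(e^{-iθ/2}, e^{iθ/2})`. -/
noncomputable def matRz (θ : ℝ) : Matrix (Fin 2) (Fin 2) ℂ :=
  !![Complex.exp (-(Complex.I * (θ : ℂ) / 2)), 0; 0, Complex.exp (Complex.I * (θ : ℂ) / 2)]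

/-- The elementary gates on `k` qubits in a line. A CNOT acts on two neighbouring qubits only,
with either of them as the control. -/
inductive Gate (k : ℕ) : Type
  | cnot (c t : Fin k) (adj : (c : ℕ) + 1 = (t : ℕ) ∨ (t : ℕ) + 1 = (c : ℕ)) : Gate k
  | tee (q : Fin k) : Gate k
  | teeDagger (q : Fin k) : Gate k
  | hadamard (q : Fin k) : Gate k
  | rz (θ : ℝ) (q : Fin k) : Gate k

/-- The operator that an elementary gate applies. -/
noncomputable def Gate.toOperator {k : ℕ} : Gate k → Operator k
  | .cnot c t _ => mcGate {c} t matX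
  | .tee q => mcGate ∅ q (matP (Real.pi / 4))
  | .teeDagger q => mcGate ∅ q (matP (-(Real.pi / 4)))
  | .hadamard q => mcGate ∅ q matH
  | .rz θ q => mcGate ∅ q (matRz θ)

def Gate.isCnot {k : ℕ} : Gate k → Bool
  | .cnot _ _ _ => true
  | _ => false

/-- `T` and its inverse both count as a `T` gate. -/
def Gate.isT {k : ℕ} : Gate k → Bool
  | .tee _ => true
  | .teeDagger _ => true
  | _ => false

def Gate.isH {k : ℕ} : Gate k → Bool
  | .hadamard _ => true
  | _ => false

def Gate.isRz {k : ℕ} : Gate k → Bool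
  | .rz _ _ => true
  | _ => false

/-- A circuit is a list of elementary gates; the head of the list is applied first. -/
abbrev Circuit (k : ℕ) : Type := List (Gate k)

/-- The operator that a circuit applies. -/
noncomputable def Circuit.toOperator {k : ℕ} : Circuit k → Operator k
  | [] => 1
  | g :: l => Circuit.toOperator l * g.toOperator

/-- The circuit applies the operator `A` (exactly, not only up to a global phase) and uses at most
the given numbers of CNOT, `T`, `H` and `R_z` gates. -/
def Circuit.ImplementsWithin {k : ℕ} (l : Circuit k) (A : Operator k)
    (cnots ts hs rzs : ℤ) : Prop :=
  Circuit.toOperator l = A ∧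
    (l.countP Gate.isCnot : ℤ) ≤ cnots ∧
    (l.countP Gate.isT : ℤ) ≤ ts ∧
    (l.countP Gate.isH : ℤ) ≤ hs ∧
    (l.countP Gate.isRz : ℤ) ≤ rzs

end LNN

/-! Diagonalization in SU(2) writes `W = V * matRz θ * V⁻¹` with `V = matRz α * H * matRz β * H`
(`exists_conj_matRz`). Only the middle factor needs controls, since `V` cancels when it is absent,
so the two outer factors cost 4 `R_z` and 4 `H` (`realizable_mcGate_of_matRz`).

A controlled `R_z` comes from reflections: an involution `N` inverts `matRz a` under conjugation if
it is off-diagonal, and fixes it if it is diagonal. Hence `N * matRz (-(θ/2)) * N * matRz (θ/2)` is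
`matRz θ` or `1`. For controls on both sides of the target, the square of `N * matRz (-(θ/4)) * N' *
matRz (θ/4)` is `matRz θ` if both are off-diagonal and `1` if either is diagonal. This accounts for
6 and 8 rotations.

To build `N`, take a diagonal sign operator whose block on the target is `±Z` if the controls of one
side are on and `±1` otherwise, and conjugate it by a self-inverse gate `o` on the target. The sign
depends on the other qubits but is harmless, as `N` occurs twice. The sign operator comes from a
ladder (`exists_chainPhase`): a CZ at the furthest control, conjugated successively by CNOTs, or by
relative-phase Toffolis where a control is met, until it reaches the target. The ladder cannot
cheaply include the neighbours of the target; these are absorbed by `o` (`exists_tilts`), which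
takes `Z` to an off-diagonal matrix exactly when they are on. -/

namespace LNN

open Function

variable {k : ℕ}

/-! ### Block operators on one qubit -/

/-- The block operator acting on the qubit `t` by the matrix `F y`, where `y` is the label with
the qubit `t` reset to `0`. -/
def ctl (t : Fin k) (F : Basis k → Matrix (Fin 2) (Fin 2) ℂ) : Operator k :=
  fun x y => if ∀ j, j ≠ t → x j = y j then F (update y t 0) (x t) (y t) else 0

theorem ctl_congr {t : Fin k} {F G : Basis k → Matrix (Fin 2) (Fin 2) ℂ}
    (h : ∀ y, y t = 0 → F y = G y) : ctl t F = ctl t G := by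
  ext x y
  simp only [ctl, h (update y t 0) (by simp)]

theorem ctl_mul (t : Fin k) (F G : Basis k → Matrix (Fin 2) (Fin 2) ℂ) :
    ctl t F * ctl t G = ctl t (fun y => F y * G y) := by
  ext x y
  rw [Matrix.mul_apply]
  -- Only the two intermediate labels that agree with `y` away from `t` contribute to the matrix
  -- product.
  have key := Fintype.sum_of_injective (fun v : Fin 2 => update y t v)
    (update_injective y t)
    (fun v => ctl t F x (update y t v) * ctl t G (update y t v) y)
    (fun z => ctl t F x z * ctl t G z y)
    (by
      intro z hz
      have : ¬ ∀ j, j ≠ t → z j = y j := by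
        intro h
        refine hz ⟨z t, ?_⟩
        ext j
        by_cases hj : j = t
        · subst hj; simp
        · simp [hj, h j hj]
      simp [ctl, this])
    (fun _ => rfl)
  rw [← key]
  have h1 : ∀ v : Fin 2, (∀ j, j ≠ t → update y t v j = y j) ↔ True :=
    fun v => iff_true_intro fun j hj => by simp [hj]
  have h2 : ∀ v : Fin 2, (∀ j, j ≠ t → x j = update y t v j) ↔ (∀ j, j ≠ t → x j = y j) :=
    fun v => forall₂_congr fun j hj => by simp [hj]
  simp only [ctl, h1, h2, Matrix.mul_apply, if_true, update_idem, update_self]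
  split_ifs <;> simp

/-- The label `x` with the qubit `q` negated. -/
def flip (q : Fin k) (x : Basis k) : Basis k := update x q (x q + 1)

@[simp] theorem flip_same (q : Fin k) (x : Basis k) : flip q x q = x q + 1 := by simp [flip]

@[simp] theorem flip_of_ne {q j : Fin k} (h : j ≠ q) (x : Basis k) : flip q x j = x j := by
  simp [flip, h]

@[simp] theorem flip_flip (q : Fin k) (x : Basis k) : flip q (flip q x) = x := by
  ext j
  by_cases h : j = q
  · subst h
    simp only [flip_same]
    generalize x j = a
    revert a; decide
  · simp [h]

/-- A diagonal operator is a block operator for every choice of `t`. This lets the ladder conjugate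
one sign operator at successive qubits. -/
theorem diagonal_eq_ctl (t : Fin k) (s : Basis k → ℂ) :
    (Matrix.diagonal s : Operator k) = ctl t (fun y => !![s y, 0; 0, s (flip t y)]) := by
  ext x y
  simp only [ctl, Matrix.diagonal_apply]
  by_cases h : x = y
  · subst h
    have h0 : x t = 0 ∨ x t = 1 := by
      generalize x t = a
      revert a; decide
    rcases h0 with h0 | h0
    · have : update x t 0 = x := by rw [← h0]; simp
      simp [h0, this]
    · have : flip t (update x t 0) = x := by
        ext j
        by_cases hj : j = t
        · subst hj; simp [h0]
        · simp [hj]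
      simp [h0, this]
  · by_cases h' : ∀ j, j ≠ t → x j = y j
    · have hne : x t ≠ y t := fun e => h (funext fun j => by
        by_cases hj : j = t
        · subst hj; exact e
        · exact h' j hj)
      rw [if_neg h, if_pos h']
      generalize x t = a at hne
      generalize y t = b at hne ⊢
      fin_cases a <;> fin_cases b <;> simp_all
    · simp [h, h']

theorem mcGate_eq_ctl {C : Finset (Fin k)} {t : Fin k} (h : t ∉ C)
    (U : Matrix (Fin 2) (Fin 2) ℂ) :
    mcGate C t U = ctl t (fun y => if ∀ c ∈ C, y c = 1 then U else 1) := by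
  ext x y
  have : (∀ c ∈ C, update y t 0 c = 1) ↔ ∀ c ∈ C, y c = 1 :=
    forall₂_congr fun c hc => by rw [update_of_ne (by rintro rfl; exact h hc)]
  simp only [mcGate, ctl, this]
  split_ifs <;> rfl

/-! ### Realizability with bounded gate counts -/

/-- Some circuit applies `A` with at most the given numbers of CNOT, `T`, `H`, `R_z` gates. -/
def Realizable (A : Operator k) (c τ η r : ℕ) : Prop :=
  ∃ l : Circuit k, Circuit.toOperator l = A ∧ l.countP Gate.isCnot ≤ c ∧
    l.countP Gate.isT ≤ τ ∧ l.countP Gate.isH ≤ η ∧ l.countP Gate.isRz ≤ r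

theorem Circuit.toOperator_append (l₁ l₂ : Circuit k) :
    Circuit.toOperator (l₁ ++ l₂) = Circuit.toOperator l₂ * Circuit.toOperator l₁ := by
  induction l₁ with
  | nil => simp [Circuit.toOperator]
  | cons g l ih => simp [Circuit.toOperator, ih, Matrix.mul_assoc]

theorem Realizable.mul {A B : Operator k} {c τ η r c' τ' η' r' : ℕ}
    (hA : Realizable A c τ η r) (hB : Realizable B c' τ' η' r') :
    Realizable (A * B) (c + c') (τ + τ') (η + η') (r + r') := by
  obtain ⟨l, rfl, h1, h2, h3, h4⟩ := hA
  obtain ⟨l', rfl, h1', h2', h3', h4'⟩ := hB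
  refine ⟨l' ++ l, Circuit.toOperator_append _ _, ?_, ?_, ?_, ?_⟩ <;>
    rw [List.countP_append] <;> omega

theorem Realizable.ctl_mul {t : Fin k} {F G : Basis k → Matrix (Fin 2) (Fin 2) ℂ}
    {c τ η r c' τ' η' r' : ℕ}
    (hA : Realizable (ctl t F) c τ η r) (hB : Realizable (ctl t G) c' τ' η' r') :
    Realizable (ctl t fun y => F y * G y) (c + c') (τ + τ') (η + η') (r + r') :=
  LNN.ctl_mul t F G ▸ hA.mul hB

theorem Realizable.mono {A : Operator k} {c τ η r c' τ' η' r' : ℕ}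
    (hA : Realizable A c τ η r) (hc : c ≤ c') (hτ : τ ≤ τ') (hη : η ≤ η') (hr : r ≤ r') :
    Realizable A c' τ' η' r' := by
  obtain ⟨l, h, h1, h2, h3, h4⟩ := hA
  exact ⟨l, h, h1.trans hc, h2.trans hτ, h3.trans hη, h4.trans hr⟩

theorem realizable_gate (g : Gate k) :
    Realizable g.toOperator (if g.isCnot then 1 else 0) (if g.isT then 1 else 0)
      (if g.isH then 1 else 0) (if g.isRz then 1 else 0) :=
  ⟨[g], by simp [Circuit.toOperator], by simp [List.countP_cons], by simp [List.countP_cons],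
    by simp [List.countP_cons], by simp [List.countP_cons]⟩

/-- Neighbouring positions on the line. -/
def Adj (c t : Fin k) : Prop := (c : ℕ) + 1 = (t : ℕ) ∨ (t : ℕ) + 1 = (c : ℕ)

theorem Adj.symm {c t : Fin k} (h : Adj c t) : Adj t c := Or.symm h

theorem Adj.ne {c t : Fin k} (h : Adj c t) : c ≠ t := by
  rintro rfl
  rcases h with h | h <;> omega

theorem mcGate_empty (t : Fin k) (U : Matrix (Fin 2) (Fin 2) ℂ) :
    mcGate ∅ t U = ctl t (fun _ => U) := by
  rw [mcGate_eq_ctl (by simp)]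
  simp

theorem realizable_cnot {c t : Fin k} (h : Adj c t) :
    Realizable (ctl t fun y => if y c = 1 then matX else 1) 1 0 0 0 := by
  have : Realizable (mcGate {c} t matX) 1 0 0 0 := realizable_gate (Gate.cnot c t h)
  rw [mcGate_eq_ctl (by simpa using h.ne.symm)] at this
  simpa using this

theorem realizable_tee (t : Fin k) :
    Realizable (ctl t fun _ => matP (Real.pi / 4)) 0 1 0 0 := by
  have := realizable_gate (Gate.tee t)
  rwa [Gate.toOperator, mcGate_empty] at this

theorem realizable_teeDagger (t : Fin k) :
    Realizable (ctl t fun _ => matP (-(Real.pi / 4))) 0 1 0 0 := by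
  have := realizable_gate (Gate.teeDagger t)
  rwa [Gate.toOperator, mcGate_empty] at this

theorem realizable_hadamard (t : Fin k) : Realizable (ctl t fun _ => matH) 0 0 1 0 := by
  have := realizable_gate (Gate.hadamard t)
  rwa [Gate.toOperator, mcGate_empty] at this

theorem realizable_rz (θ : ℝ) (t : Fin k) : Realizable (ctl t fun _ => matRz θ) 0 0 0 1 := by
  have := realizable_gate (Gate.rz θ t)
  rwa [Gate.toOperator, mcGate_empty] at this

/-! ### Two-by-two matrices -/

/-- The primitive eighth root of unity `e^{iπ/4}`. -/
noncomputable def omega8 : ℂ := Complex.exp (Complex.I * ((Real.pi / 4 : ℝ) : ℂ))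

theorem omega8_sq : omega8 ^ 2 = Complex.I := by
  rw [omega8, ← Complex.exp_nat_mul]
  convert Complex.exp_pi_div_two_mul_I using 2
  push_cast; ring

/-- The reflection `T X T†`. -/
noncomputable def matB : Matrix (Fin 2) (Fin 2) ℂ := !![0, omega8⁻¹; omega8, 0]

theorem matP_mul_matX_mul_matP :
    matP (Real.pi / 4) * matX * matP (-(Real.pi / 4)) = matB := by
  have : Complex.exp (Complex.I * ((-(Real.pi / 4) : ℝ) : ℂ)) = omega8⁻¹ := by
    rw [omega8, ← Complex.exp_neg]; congr 1; push_cast; ring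
  have h2 : Complex.exp (Complex.I * ((Real.pi / 4 : ℝ) : ℂ)) = omega8 := rfl
  simp only [matP, matX, matB, this, h2]
  ext i j
  fin_cases i <;> fin_cases j <;> simp [Matrix.mul_apply, Fin.sum_univ_two]

theorem matP_mul_matP_neg : matP (Real.pi / 4) * matP (-(Real.pi / 4)) = 1 := by
  have h : Complex.exp (Complex.I * ((Real.pi / 4 : ℝ) : ℂ)) *
      Complex.exp (Complex.I * ((-(Real.pi / 4) : ℝ) : ℂ)) = 1 := by
    rw [← Complex.exp_add, ← Complex.exp_zero]; congr 1; push_cast; ring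
  simp only [matP]
  ext i j
  fin_cases i <;> fin_cases j <;> simp [Matrix.mul_apply, Fin.sum_univ_two]
  simpa using h

theorem realizable_matB {c t : Fin k} (h : Adj c t) :
    Realizable (ctl t fun y => if y c = 1 then matB else 1) 1 2 0 0 := by
  convert ((realizable_tee t).ctl_mul (realizable_cnot h)).ctl_mul (realizable_teeDagger t)
    using 3 with y
  split_ifs
  · exact matP_mul_matX_mul_matP.symm
  · rw [mul_one, matP_mul_matP_neg]

theorem matH_eq : ∃ a : ℂ, 2 * a ^ 2 = 1 ∧ matH = !![a, a; a, -a] := by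
  refine ⟨((1 / Real.sqrt 2 : ℝ) : ℂ), ?_, ?_⟩
  · norm_cast
    rw [div_pow, Real.sq_sqrt (by norm_num)]; norm_num
  · simp [matH]

/-- The Pauli matrix `Z`. -/
def matZ : Matrix (Fin 2) (Fin 2) ℂ := !![1, 0; 0, -1]

theorem matH_mul_self : matH * matH = 1 := by
  obtain ⟨a, ha, h⟩ := matH_eq
  rw [h, Matrix.one_fin_two, Matrix.mul_fin_two]
  ext i j
  fin_cases i <;> fin_cases j <;> simp <;> linear_combination ha

theorem matH_mul_matZ_mul_matH : matH * matZ * matH = matX := by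
  obtain ⟨a, ha, h⟩ := matH_eq
  rw [h, matZ, matX, Matrix.mul_fin_two, Matrix.mul_fin_two]
  ext i j
  fin_cases i <;> fin_cases j <;> simp <;> linear_combination ha

theorem matH_mul_matX_mul_matH : matH * matX * matH = matZ := by
  rw [← matH_mul_matZ_mul_matH]
  simp only [← mul_assoc, matH_mul_self, one_mul]
  rw [mul_assoc, matH_mul_self, mul_one]

theorem omega8_ne_zero : omega8 ≠ 0 := Complex.exp_ne_zero _

theorem matB_mul_self : matB * matB = 1 := by
  simp [matB, Matrix.one_fin_two, omega8_ne_zero]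

/-! ### Diagonal operators conjugated by relative-phase gates -/

theorem matH_mul_matY_mul_matH :
    matH * (matB * matX * matB) * matH = !![0, Complex.I; -Complex.I, 0] := by
  obtain ⟨a, ha, h⟩ := matH_eq
  have h1 : matB * matX * matB = !![0, -Complex.I; Complex.I, 0] := by
    have hi : omega8⁻¹ * omega8⁻¹ = -Complex.I := by
      rw [← mul_inv, ← sq, omega8_sq, Complex.inv_I]
    have hs : omega8 * omega8 = Complex.I := by rw [← sq, omega8_sq]
    simp [matB, matX, hi, hs]
  rw [h1, h, Matrix.mul_fin_two, Matrix.mul_fin_two]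
  ext i j
  fin_cases i <;> fin_cases j <;> simp
  · linear_combination Complex.I * ha
  · linear_combination -Complex.I * ha

/-- The relative-phase Toffoli gate with target `q` and neighbouring controls `u`, `v`. -/
theorem realizable_toffoli {u v q : Fin k} (hu : Adj u q) (hv : Adj v q) :
    Realizable (ctl q fun y => matH * ((if y u = 1 then matB else 1) *
      (if y v = 1 then matX else 1) * (if y u = 1 then matB else 1)) * matH) 3 4 2 0 :=
  ((realizable_hadamard q).ctl_mul (((realizable_matB hu).ctl_mul (realizable_cnot hv)).ctl_mul
    (realizable_matB hu))).ctl_mul (realizable_hadamard q)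

/-- The conjugating gate is `1` or `Z`, which commutes with diagonal matrices, unless both controls
are on; then it is a Pauli `Y` up to sign, which swaps the entries. Its phases relative to a true
Toffoli cancel here, which is why the cheap version with 3 CNOTs and 4 `T` gates suffices. -/
theorem toffoli_conj_diagonal (u v : Prop) [Decidable u] [Decidable v] (a b : ℂ) :
    matH * ((if u then matB else 1) * (if v then matX else 1) * (if u then matB else 1)) * matH *
      !![a, 0; 0, b] *
      (matH * ((if u then matB else 1) * (if v then matX else 1) * (if u then matB else 1)) * matH)
      = if u ∧ v then !![b, 0; 0, a] else !![a, 0; 0, b] := by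
  by_cases hu : u <;> by_cases hv : v
  · simp only [hu, hv, if_true, and_self, matH_mul_matY_mul_matH]
    ext i j
    fin_cases i <;> fin_cases j <;> simp
    · linear_combination -b * Complex.I_sq
    · linear_combination -a * Complex.I_sq
  · simp [hu, hv, matB_mul_self, matH_mul_self]
  · simp [hu, hv, matH_mul_matX_mul_matH, matZ]
  · simp [hu, hv, matH_mul_self]

/-- Conjugation by a classically controlled swap of the two values of `q` precomposes the diagonal
with that permutation; `hP` says that the condition does not read `q` itself. -/
theorem realizable_diagonal_conj {q : Fin k} {R : Basis k → Matrix (Fin 2) (Fin 2) ℂ}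
    {P : Basis k → Prop} [DecidablePred P] {s : Basis k → ℂ} {c τ η r c' τ' η' r' : ℕ}
    (hR : Realizable (ctl q R) c τ η r)
    (h : ∀ y a b, R y * !![a, 0; 0, b] * R y = if P y then !![b, 0; 0, a] else !![a, 0; 0, b])
    (hP : ∀ y, P (flip q y) ↔ P y) (hs : Realizable (Matrix.diagonal s) c' τ' η' r') :
    Realizable (Matrix.diagonal fun x => if P x then s (flip q x) else s x)
      (2 * c + c') (2 * τ + τ') (2 * η + η') (2 * r + r') := by
  rw [diagonal_eq_ctl q] at hs ⊢
  refine Realizable.mono (A := ctl q _) ?_ (show c + c' + c ≤ _ by omega)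
    (show τ + τ' + τ ≤ _ by omega) (show η + η' + η ≤ _ by omega) (show r + r' + r ≤ _ by omega)
  convert (hR.ctl_mul hs).ctl_mul hR using 3 with y
  simp only [hP, flip_flip]
  rw [h]
  split_ifs <;> simp

/-- The controlled-`Z` gate on two neighbouring qubits. -/
theorem realizable_cz {c t : Fin k} (h : Adj c t) :
    Realizable (Matrix.diagonal fun x : Basis k => if x c = 1 ∧ x t = 1 then -1 else 1)
      1 0 2 0 := by
  rw [diagonal_eq_ctl t]
  have := ((realizable_hadamard t).ctl_mul (realizable_cnot h)).ctl_mul (realizable_hadamard t)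
  rw [ctl_congr (G := fun y => if y c = 1 then matZ else 1)] at this
  · convert this using 1
    refine ctl_congr fun y hy => ?_
    by_cases hc : y c = 1 <;> simp [hc, hy, h.ne, matZ, Matrix.one_fin_two]
  · intro y _
    split_ifs
    · exact matH_mul_matX_mul_matH
    · simp [matH_mul_self]

/-! ### Phases computed by a ladder along a chain of qubits -/

/-- The controls of the chain `p 0, …, p m` other than its first two qubits are on; the last
qubit always counts as a control. -/
def ChainOn (p : ℕ → Fin k) (m : ℕ) (D : Finset (Fin k)) (x : Basis k) : Prop :=
  x (p m) = 1 ∧ ∀ i, 2 ≤ i → i < m → p i ∈ D → x (p i) = 1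

/-- A sign `s` on the labels of a chain that changes with the qubit `p 0` precisely when the
controls are on. -/
structure ChainPhase (p : ℕ → Fin k) (m : ℕ) (D : Finset (Fin k)) (s : Basis k → ℂ) : Prop where
  sq : ∀ x, s x * s x = 1
  flip_on : ∀ x, ChainOn p m D x → s (flip (p 0) x) = -s x
  flip_off : ∀ x, ¬ ChainOn p m D x → s (flip (p 0) x) = s x
  flip_other : ∀ j x, (∀ i ≤ m, p i ≠ j) → s (flip j x) = s x

theorem chainOn_flip {p : ℕ → Fin k} {m : ℕ} {D : Finset (Fin k)} {j : Fin k} (x : Basis k)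
    (hm : p m ≠ j) (h : ∀ i, 2 ≤ i → i < m → p i ≠ j) :
    ChainOn p m D (flip j x) ↔ ChainOn p m D x := by
  unfold ChainOn
  rw [flip_of_ne hm]
  refine and_congr_right fun _ => forall₃_congr fun i h2 hi => ?_
  rw [flip_of_ne (h i h2 hi)]

/-- Flipping `p 0` toggles between `s x` and `s (flip (p 1) x)` when the new control `p 2` is on,
and does nothing otherwise. By hypothesis on the shorter chain, which starts at `p 1`, these two
values differ by a sign exactly when its controls are on. -/
theorem ChainPhase.step {p : ℕ → Fin k} {m : ℕ} {D : Finset (Fin k)} {s : Basis k → ℂ}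
    (hm : 1 ≤ m) (hinj : ∀ i j, i ≤ m + 1 → j ≤ m + 1 → p i = p j → i = j)
    (hs : ChainPhase (fun i => p (i + 1)) m D s) :
    ChainPhase p (m + 1) D fun x =>
      if x (p 0) = 1 ∧ (2 ≤ m ∧ p 2 ∈ D → x (p 2) = 1) then s (flip (p 1) x) else s x := by
  have h0 : ∀ i, 1 ≤ i → i ≤ m + 1 → p i ≠ p 0 := fun i h1 h2 e => by
    have := hinj i 0 h2 (by omega) e
    omega
  have hoff : ∀ x, s (flip (p 0) x) = s x := fun x =>
    hs.flip_other _ x fun i hi => h0 _ (by omega) (by omega)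
  -- Each side is the same sign times `s x`, because flipping `p 0` affects neither `s` nor the
  -- controls of the shorter chain.
  have hoff' : ∀ x, s (flip (p 1) (flip (p 0) x)) = s (flip (p 1) x) := fun x => by
    have e : ChainOn (fun i => p (i + 1)) m D (flip (p 0) x) ↔
        ChainOn (fun i => p (i + 1)) m D x :=
      chainOn_flip x (h0 _ (by omega) (by omega)) fun i _ hi => h0 _ (by omega) (by omega)
    by_cases h : ChainOn (fun i => p (i + 1)) m D x
    · rw [hs.flip_on _ h, hs.flip_on _ (e.2 h), hoff]
    · rw [hs.flip_off _ h, hs.flip_off _ (fun h' => h (e.1 h')), hoff]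
  have hon : ∀ x, ChainOn p (m + 1) D x ↔
      ChainOn (fun i => p (i + 1)) m D x ∧ (2 ≤ m ∧ p 2 ∈ D → x (p 2) = 1) := by
    intro x
    constructor
    · rintro ⟨h1, h2⟩
      exact ⟨⟨h1, fun i hi hi' => h2 _ (by omega) (by omega)⟩,
        fun h => h2 2 le_rfl (by omega) h.2⟩
    · rintro ⟨⟨h1, h2⟩, h3⟩
      refine ⟨h1, fun i hi hi' hD => ?_⟩
      obtain rfl | hlt := eq_or_lt_of_le hi
      · exact h3 ⟨by omega, hD⟩
      · obtain ⟨i, rfl⟩ : ∃ i', i = i' + 1 := ⟨i - 1, by omega⟩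
        exact h2 i (by omega) (by omega) hD
  have h2 : ∀ x, (2 ≤ m ∧ p 2 ∈ D → flip (p 0) x (p 2) = 1) ↔
      (2 ≤ m ∧ p 2 ∈ D → x (p 2) = 1) := fun x =>
    imp_congr_right fun h => by rw [flip_of_ne (h0 2 (by omega) (by omega))]
  have hx : ∀ x : Basis k, flip (p 0) x (p 0) = 1 ↔ ¬ x (p 0) = 1 := fun x => by
    rw [flip_same]
    generalize x (p 0) = a
    revert a; decide
  refine ⟨fun x => ?_, fun x h => ?_, fun x h => ?_, fun j x hj => ?_⟩
  · split_ifs <;> exact hs.sq _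
  · rw [hon] at h
    simp only [h2, hx, hoff, hoff']
    have e1 := hs.flip_on x h.1
    by_cases hx0 : x (p 0) = 1
    · rw [if_neg (by simp [hx0]), if_pos ⟨hx0, h.2⟩, e1, neg_neg]
    · rw [if_pos ⟨hx0, h.2⟩, if_neg (by simp [hx0]), e1]
  · rw [hon] at h
    simp only [h2, hx, hoff, hoff']
    by_cases hc : (2 ≤ m ∧ p 2 ∈ D → x (p 2) = 1)
    · have e1 : s (flip (p 1) x) = s x := hs.flip_off x fun h' => h ⟨h', hc⟩
      simp only [e1, ite_self]
    · rw [if_neg (fun h => hc h.2), if_neg (fun h => hc h.2)]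
  · have hj' : s (flip j x) = s x := hs.flip_other j x fun i hi => hj _ (by omega)
    have hj1 : s (flip (p 1) (flip j x)) = s (flip (p 1) x) := by
      have e : ChainOn (fun i => p (i + 1)) m D (flip j x) ↔
          ChainOn (fun i => p (i + 1)) m D x :=
        chainOn_flip x (hj _ (by omega)) fun i _ hi => hj _ (by omega)
      by_cases h : ChainOn (fun i => p (i + 1)) m D x
      · rw [hs.flip_on _ h, hs.flip_on _ (e.2 h), hj']
      · rw [hs.flip_off _ h, hs.flip_off _ (fun h' => h (e.1 h')), hj']
    simp only [hj', hj1, flip_of_ne (hj 0 (by omega))]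
    by_cases hc : 2 ≤ m ∧ p 2 ∈ D
    · rw [flip_of_ne (hj 2 (by omega))]
    · simp only [hc, false_imp_iff]

theorem chainPhase_one {p : ℕ → Fin k} (D : Finset (Fin k)) (h : p 0 ≠ p 1) :
    ChainPhase p 1 D fun x => if x (p 0) = 1 ∧ x (p 1) = 1 then -1 else 1 := by
  have hon : ∀ x, ChainOn p 1 D x ↔ x (p 1) = 1 := fun x =>
    ⟨fun h => h.1, fun h => ⟨h, fun i h1 h2 => by omega⟩⟩
  have hx : ∀ x : Basis k, flip (p 0) x (p 0) = 1 ↔ ¬ x (p 0) = 1 := fun x => by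
    rw [flip_same]
    generalize x (p 0) = a
    revert a; decide
  refine ⟨fun x => by split_ifs <;> norm_num, fun x hx' => ?_, fun x hx' => ?_, fun j x hj => ?_⟩
  · rw [hon] at hx'
    simp only [hx, flip_of_ne h.symm, hx', and_true]
    split_ifs <;> simp_all
  · rw [hon] at hx'
    simp [flip_of_ne h.symm, hx']
  · rw [flip_of_ne (hj 0 (by omega)), flip_of_ne (hj 1 le_rfl)]

theorem exists_chainPhase (D : Finset (Fin k)) (m : ℕ) (hm : 1 ≤ m) :
    ∀ p : ℕ → Fin k, (∀ i < m, Adj (p i) (p (i + 1))) →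
      (∀ i j, i ≤ m → j ≤ m → p i = p j → i = j) →
      ∃ s, ChainPhase p m D s ∧ ∀ N, N = ∑ i ∈ Finset.Ico 2 m, (if p i ∈ D then 1 else 0) →
        Realizable (Matrix.diagonal s) (4 * N + 2 * m - 1) (8 * N) (4 * N + 2) 0 := by
  induction m, hm using Nat.le_induction with
  | base =>
    intro p hadj _
    refine ⟨_, chainPhase_one D (hadj 0 one_pos).ne, ?_⟩
    rintro N rfl
    simpa using realizable_cz (hadj 0 one_pos)
  | succ m hm ih =>
    intro p hadj hinj
    obtain ⟨s, hs, hr⟩ := ih (fun i => p (i + 1)) (fun i hi => hadj _ (by omega))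
      fun i j hi hj e => by
        have := hinj _ _ (by omega) (by omega) e
        omega
    refine ⟨_, hs.step hm hinj, ?_⟩
    rintro N rfl
    have hr' := hr _ rfl
    rw [Finset.sum_Ico_add' (fun i => if p i ∈ D then 1 else 0) 2 m 1] at hr'
    have h01 : p 0 ≠ p 1 := (hadj 0 (by omega)).ne
    have a0 : Adj (p 0) (p 1) := hadj 0 (by omega)
    -- A Toffoli pair adds 6 CNOTs, 8 `T` and 4 `H`; a CNOT pair adds 2 CNOTs. If `m = 1`, then `p
    -- 2` is the end of the chain, already a control of the CZ, so a CNOT pair suffices.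
    by_cases hc : 2 ≤ m ∧ p 2 ∈ D
    · have h12 : Adj (p 2) (p 1) := (hadj 1 (by omega)).symm
      rw [Finset.sum_eq_sum_Ico_succ_bot (by omega), if_pos hc.2]
      refine (realizable_diagonal_conj (realizable_toffoli h12 a0)
        (P := fun x => x (p 0) = 1 ∧ (2 ≤ m ∧ p 2 ∈ D → x (p 2) = 1)) ?_ ?_ hr').mono ?_ ?_ ?_ ?_
      · intro y a b
        rw [toffoli_conj_diagonal]
        simp only [hc, and_self, true_imp_iff, and_comm]
      · intro y
        simp only [flip_of_ne h01, flip_of_ne h12.ne]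
      all_goals omega
    · have hN : ∑ i ∈ Finset.Ico (2 + 1) (m + 1), (if p i ∈ D then 1 else 0) =
          ∑ i ∈ Finset.Ico 2 (m + 1), if p i ∈ D then 1 else 0 := by
        by_cases h2 : 2 ≤ m
        · rw [Finset.sum_eq_sum_Ico_succ_bot (show 2 < m + 1 by omega),
            if_neg fun h => hc ⟨h2, h⟩, zero_add]
        · rw [Finset.Ico_eq_empty (by omega), Finset.Ico_eq_empty (by omega)]
      rw [hN] at hr'
      refine (realizable_diagonal_conj (realizable_cnot a0)
        (P := fun x => x (p 0) = 1 ∧ (2 ≤ m ∧ p 2 ∈ D → x (p 2) = 1)) ?_ ?_ hr').mono ?_ ?_ ?_ ?_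
      · intro y a b
        simp only [hc, false_imp_iff, and_true]
        split_ifs <;> simp [matX]
      · intro y
        simp only [hc, false_imp_iff, and_true, flip_of_ne h01]
      all_goals omega

/-! ### Rotations and reflections of a single qubit -/

theorem matRz_add (a b : ℝ) : matRz (a + b) = matRz a * matRz b := by
  simp only [matRz, Matrix.mul_fin_two, mul_zero, zero_mul, add_zero, zero_add, ← Complex.exp_add]
  congr! 4 <;> push_cast <;> ring_nf

theorem matRz_zero : matRz 0 = 1 := by
  simp [matRz, Matrix.one_fin_two]

theorem matRz_mul_neg (a : ℝ) : matRz a * matRz (-a) = 1 := by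
  rw [← matRz_add, add_neg_cancel, matRz_zero]

theorem matRz_neg_mul (a : ℝ) : matRz (-a) * matRz a = 1 := by
  rw [← matRz_add, neg_add_cancel, matRz_zero]

/-- Both diagonal entries vanish. -/
def OffDiag (M : Matrix (Fin 2) (Fin 2) ℂ) : Prop := M 0 0 = 0 ∧ M 1 1 = 0

/-- Both off-diagonal entries vanish. -/
def OnDiag (M : Matrix (Fin 2) (Fin 2) ℂ) : Prop := M 0 1 = 0 ∧ M 1 0 = 0

theorem OffDiag.mul_matRz {M : Matrix (Fin 2) (Fin 2) ℂ} (h : OffDiag M) (a : ℝ) :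
    M * matRz a = matRz (-a) * M := by
  obtain ⟨h0, h1⟩ := h
  ext i j
  fin_cases i <;> fin_cases j <;>
    simp [Matrix.mul_apply, Fin.sum_univ_two, matRz, h0, h1, mul_comm, neg_div]

theorem OnDiag.mul_matRz {M : Matrix (Fin 2) (Fin 2) ℂ} (h : OnDiag M) (a : ℝ) :
    M * matRz a = matRz a * M := by
  obtain ⟨h0, h1⟩ := h
  ext i j
  fin_cases i <;> fin_cases j <;>
    simp [Matrix.mul_apply, Fin.sum_univ_two, matRz, h0, h1, mul_comm]

/-- `H B H` is halfway between a diagonal and an off-diagonal reflection: `u ^ 2 + v ^ 2 = 0` is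
what kills the diagonal of its conjugate of `Z`. -/
theorem matK_eq : ∃ u v : ℂ, 2 * u ^ 2 = 1 ∧ 2 * v ^ 2 = -1 ∧
    matH * matB * matH = !![u, v; -v, -u] := by
  obtain ⟨a, ha, h⟩ := matH_eq
  have h1 := omega8_sq
  have h2 : omega8⁻¹ ^ 2 = -Complex.I := by rw [inv_pow, omega8_sq, Complex.inv_I]
  have h3 := mul_inv_cancel₀ omega8_ne_zero
  refine ⟨a ^ 2 * (omega8 + omega8⁻¹), a ^ 2 * (omega8 - omega8⁻¹), ?_, ?_, ?_⟩
  · have : (2 * a ^ 2) * (2 * a ^ 2) = 1 := by rw [ha, one_mul]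
    linear_combination 2 * a ^ 4 * (h1 + h2 + 2 * h3) + this
  · have : (2 * a ^ 2) * (2 * a ^ 2) = 1 := by rw [ha, one_mul]
    linear_combination 2 * a ^ 4 * (h1 + h2 - 2 * h3) - this
  · rw [h, matB, Matrix.mul_fin_two, Matrix.mul_fin_two]
    ext i j
    fin_cases i <;> fin_cases j <;> simp <;> ring

theorem offDiag_matK : OffDiag (matH * matB * matH * matZ * (matH * matB * matH)) := by
  obtain ⟨u, v, hu, hv, h⟩ := matK_eq
  rw [h]
  constructor <;> simp [matZ]
  · linear_combination (hu + hv) / 2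
  · linear_combination -(hu + hv) / 2

theorem matK_mul_self : matH * matB * matH * (matH * matB * matH) = 1 := by
  rw [show matH * matB * matH * (matH * matB * matH) =
    matH * (matB * (matH * matH) * matB) * matH by simp only [mul_assoc], matH_mul_self, mul_one,
    matB_mul_self, mul_one, matH_mul_self]

theorem offDiag_matK_matB_matK :
    OffDiag (matH * matB * matH * matB * (matH * matB * matH) * matZ *
      (matH * matB * matH * matB * (matH * matB * matH))) := by
  obtain ⟨u, v, hu, hv, h⟩ := matK_eq
  -- The inner conjugate of `Z` is off-diagonal; conjugating it by `matB` yields a multiple of `X`,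
  -- which `H B H` sends again to an off-diagonal matrix.
  have h1 : matB * (matH * matB * matH * matZ * (matH * matB * matH)) * matB =
      (2 * u * v * Complex.I) • matX := by
    have hi : omega8⁻¹ * omega8⁻¹ = -Complex.I := by
      rw [← mul_inv, ← sq, omega8_sq, Complex.inv_I]
    have hs : omega8 * omega8 = Complex.I := by rw [← sq, omega8_sq]
    have hw := mul_inv_cancel₀ omega8_ne_zero
    rw [h]
    ext i j
    fin_cases i <;> fin_cases j <;> simp [matB, matX, matZ, omega8_ne_zero]
    · linear_combination (hu + hv) * (-1 / 2)
    · linear_combination (-2 * u * v) * hi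
    · linear_combination (2 * u * v) * hs
    · linear_combination (hu + hv) / 2
  rw [show matH * matB * matH * matB * (matH * matB * matH) * matZ *
      (matH * matB * matH * matB * (matH * matB * matH)) =
      matH * matB * matH * (matB * (matH * matB * matH * matZ * (matH * matB * matH)) * matB) *
        (matH * matB * matH) by simp only [mul_assoc], h1, h]
  constructor <;> simp [matX] <;> ring

theorem offDiag_matH : OffDiag (matH * matZ * matH) := by
  rw [matH_mul_matZ_mul_matH]
  simp [OffDiag, matX]

theorem onDiag_matZ : OnDiag matZ := by simp [OnDiag, matZ]

theorem onDiag_matB : OnDiag (matB * matZ * matB) := by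
  simp [OnDiag, matZ, matB]

/-- A self-inverse gate `o` on `t` that turns `Z` into an off-diagonal matrix if the condition
`P` holds, and into a diagonal one otherwise. -/
structure Tilts (P : Basis k → Prop) (o : Basis k → Matrix (Fin 2) (Fin 2) ℂ) : Prop where
  mul_self : ∀ y, o y * o y = 1
  offDiag : ∀ y, P y → OffDiag (o y * matZ * o y)
  onDiag : ∀ y, ¬ P y → OnDiag (o y * matZ * o y)

theorem realizable_matK {c t : Fin k} (h : Adj c t) :
    Realizable (ctl t fun y => if y c = 1 then matH * matB * matH else 1) 1 2 2 0 := by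
  convert ((realizable_hadamard t).ctl_mul (realizable_matB h)).ctl_mul (realizable_hadamard t)
    using 3 with y
  split_ifs
  · rfl
  · rw [mul_one, matH_mul_self]

/-- With `K = H B H`, the gate is `H`, `K` controlled by the one neighbour, or the sandwich `K B K`
with `K` and `B` controlled by different neighbours. In the sandwich, if only `K` is on the two
copies cancel, and if only `B` is on `Z` stays diagonal. -/
theorem exists_tilts {t : Fin k} {E : Finset (Fin k)} (hE : ∀ e ∈ E, Adj e t) (h2 : E.card ≤ 2) :
    ∃ o c τ η, Realizable (ctl t o) c τ η 0 ∧ Tilts (fun y => ∀ e ∈ E, y e = 1) o ∧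
      (E.card = 0 ∧ c = 0 ∧ τ = 0 ∧ η = 1 ∨ E.card = 1 ∧ c = 1 ∧ τ = 2 ∧ η = 2 ∨
        E.card = 2 ∧ c = 3 ∧ τ = 6 ∧ η = 4) := by
  have hc : E.card = 0 ∨ E.card = 1 ∨ E.card = 2 := by omega
  rcases hc with hc | hc | hc
  · obtain rfl := Finset.card_eq_zero.1 hc
    exact ⟨_, 0, 0, 1, realizable_hadamard t, ⟨fun _ => matH_mul_self, fun _ _ => offDiag_matH,
      fun y h => absurd (by simp) h⟩, by simp⟩
  · obtain ⟨e, rfl⟩ := Finset.card_eq_one.1 hc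
    refine ⟨_, 1, 2, 2, realizable_matK (hE e (by simp)), ⟨fun y => ?_, fun y h => ?_,
      fun y h => ?_⟩, by simp⟩
    · split_ifs
      · exact matK_mul_self
      · exact one_mul 1
    · rw [if_pos (h e (by simp))]
      exact offDiag_matK
    · rw [if_neg (by simpa using h), one_mul, mul_one]
      exact onDiag_matZ
  · obtain ⟨e, f, hef, rfl⟩ := Finset.card_eq_two.1 hc
    have hK := realizable_matK (hE e (by simp))
    refine ⟨_, 3, 6, 4, (hK.ctl_mul (realizable_matB (hE f (by simp)))).ctl_mul hK,
      ⟨fun y => ?_, fun y h => ?_, fun y h => ?_⟩, by simp [hef]⟩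
    · have e1 : ∀ K B : Matrix (Fin 2) (Fin 2) ℂ, K * K = 1 → B * B = 1 →
          K * B * K * (K * B * K) = 1 := fun K B hK hB => by
        rw [show K * B * K * (K * B * K) = K * (B * (K * K) * B) * K by simp only [mul_assoc], hK,
          mul_one, hB, mul_one, hK]
      apply e1 <;> split_ifs <;> simp [matB_mul_self, matK_mul_self]
    · rw [if_pos (h e (by simp)), if_pos (h f (by simp))]
      exact offDiag_matK_matB_matK
    · by_cases h1 : y e = 1 <;> by_cases h2 : y f = 1
      · exact absurd (by simp [h1, h2]) h
      · simp only [h1, h2, if_true, if_false, mul_one, matK_mul_self, one_mul]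
        exact onDiag_matZ
      · simp only [h1, h2, if_true, if_false, mul_one, one_mul]
        exact onDiag_matB
      · simp only [h1, h2, if_false, mul_one, one_mul]
        exact onDiag_matZ

/-! ### Diagonalization in the special unitary group -/

/-- Here `θ` is the rotation angle and `β`, `α` are spherical coordinates of the rotation axis: `β`
is the polar angle of the point `(-Im a, ‖b‖)`, at distance `sin (θ / 2)` from the origin, and `α`
is the argument of `b`. -/
theorem exists_angles {a b : ℂ} (h : Complex.normSq a + Complex.normSq b = 1) :
    ∃ α β θ : ℝ, a = Real.cos (θ / 2) - Complex.I * (Real.sin (θ / 2) * Real.cos β : ℝ) ∧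
      b = (Real.sin (θ / 2) * Real.sin β : ℝ) * Complex.exp (Complex.I * α) := by
  set x := a.re
  set y := a.im
  have hx : x ^ 2 + y ^ 2 + ‖b‖ ^ 2 = 1 := by
    rw [Complex.normSq_apply, Complex.normSq_eq_norm_sq b] at h
    linear_combination h
  have hx1 : x ^ 2 ≤ 1 := by nlinarith [sq_nonneg y, sq_nonneg ‖b‖]
  set θ := 2 * Real.arccos x
  have hθ : θ / 2 = Real.arccos x := by ring
  have hc : Real.cos (θ / 2) = x := by
    rw [hθ, Real.cos_arccos (by nlinarith) (by nlinarith)]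
  set σ := Real.sin (θ / 2)
  have hσ : σ ^ 2 = y ^ 2 + ‖b‖ ^ 2 := by
    have := Real.sin_sq_add_cos_sq (θ / 2)
    rw [hc] at this
    linear_combination this - hx
  have hσ0 : 0 ≤ σ := by
    simp only [σ, hθ, Real.sin_arccos]
    positivity
  obtain ⟨β, hb1, hb2⟩ : ∃ β : ℝ, σ * Real.cos β = -y ∧ σ * Real.sin β = ‖b‖ := by
    refine ⟨Complex.arg ⟨-y, ‖b‖⟩, ?_⟩
    have hn : ‖(⟨-y, ‖b‖⟩ : ℂ)‖ = σ := by
      rw [← sq_eq_sq₀ (norm_nonneg _) hσ0, ← Complex.normSq_eq_norm_sq, Complex.normSq_mk, hσ]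
      ring
    rw [← hn]
    exact ⟨Complex.norm_mul_cos_arg _, Complex.norm_mul_sin_arg _⟩
  refine ⟨Complex.arg b, β, θ, ?_, ?_⟩
  · rw [hb1, hc]
    apply Complex.ext <;> simp [x, y]
  · rw [hb2, mul_comm Complex.I, Complex.norm_mul_exp_arg_mul_I]

theorem matH_mul_matRz_mul_matH (β : ℝ) : matH * matRz β * matH =
    !![(Real.cos (β / 2) : ℂ), -(Complex.I * Real.sin (β / 2));
      -(Complex.I * Real.sin (β / 2)), (Real.cos (β / 2) : ℂ)] := by
  obtain ⟨a, ha, h⟩ := matH_eq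
  have h1 : Complex.exp (Complex.I * β / 2) =
      Real.cos (β / 2) + Real.sin (β / 2) * Complex.I := by
    rw [show Complex.I * β / 2 = ((β / 2 : ℝ) : ℂ) * Complex.I by push_cast; ring,
      Complex.exp_mul_I]
    simp
  have h2 : Complex.exp (-(Complex.I * β / 2)) =
      Real.cos (β / 2) - Real.sin (β / 2) * Complex.I := by
    rw [show -(Complex.I * β / 2) = ((-(β / 2) : ℝ) : ℂ) * Complex.I by push_cast; ring,
      Complex.exp_mul_I]
    simp [sub_eq_add_neg]
  rw [h, matRz, h1, h2, Matrix.mul_fin_two, Matrix.mul_fin_two]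
  ext i j
  fin_cases i <;> fin_cases j <;> simp
  · linear_combination Complex.cos (β / 2) * ha
  · linear_combination -Complex.I * Complex.sin (β / 2) * ha
  · linear_combination -Complex.I * Complex.sin (β / 2) * ha
  · linear_combination Complex.cos (β / 2) * ha

theorem exists_conj_matRz {W : Matrix (Fin 2) (Fin 2) ℂ}
    (hW : W ∈ Matrix.specialUnitaryGroup (Fin 2) ℂ) :
    ∃ α β θ : ℝ, W = matRz α * (matH * matRz β * matH) * matRz θ *
      ((matH * matRz (-β) * matH) * matRz (-α)) := by
  rw [Matrix.mem_specialUnitaryGroup_iff, Matrix.mem_unitaryGroup_iff'] at hW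
  obtain ⟨hU, hdet⟩ := hW
  -- With determinant 1 the inverse is the adjugate, so the first row of `W` determines the second.
  have hstar : star W = Matrix.adjugate W := by
    rw [← mul_one (star W), ← one_smul ℂ (1 : Matrix (Fin 2) (Fin 2) ℂ), ← hdet,
      ← Matrix.mul_adjugate, ← mul_assoc, hU, one_mul]
  rw [Matrix.adjugate_fin_two] at hstar
  have h11 : W 1 1 = star (W 0 0) := by simpa using (congrFun₂ hstar 0 0).symm
  have h10 : W 1 0 = -star (W 0 1) := by simpa [neg_eq_iff_eq_neg] using (congrFun₂ hstar 1 0).symm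
  obtain ⟨α, β, θ, ha, hb⟩ := exists_angles (a := W 0 0) (b := W 0 1) <| by
    rw [Matrix.det_fin_two, h11, h10] at hdet
    have : (Complex.normSq (W 0 0) : ℂ) + Complex.normSq (W 0 1) = 1 := by
      rw [← hdet, ← Complex.mul_conj, ← Complex.mul_conj]
      simp
    exact_mod_cast this
  refine ⟨-α, β, θ, ?_⟩
  have hβ : Real.cos β = Real.cos (β / 2) ^ 2 - Real.sin (β / 2) ^ 2 := by
    rw [← Real.cos_two_mul']; congr 1; ring
  have hβ' : Real.sin β = 2 * Real.sin (β / 2) * Real.cos (β / 2) := by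
    rw [← Real.sin_two_mul]; congr 1; ring
  have hcs := Real.sin_sq_add_cos_sq (β / 2)
  have h1 : Complex.exp (Complex.I * θ / 2) =
      Real.cos (θ / 2) + Real.sin (θ / 2) * Complex.I := by
    rw [show Complex.I * θ / 2 = ((θ / 2 : ℝ) : ℂ) * Complex.I by push_cast; ring,
      Complex.exp_mul_I]
    simp
  have h2 : Complex.exp (-(Complex.I * θ / 2)) =
      Real.cos (θ / 2) - Real.sin (θ / 2) * Complex.I := by
    rw [show -(Complex.I * θ / 2) = ((-(θ / 2) : ℝ) : ℂ) * Complex.I by push_cast; ring,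
      Complex.exp_mul_I]
    simp [sub_eq_add_neg]
  have hmid : matH * matRz β * matH * matRz θ * (matH * matRz (-β) * matH) =
      !![W 0 0, (Real.sin (θ / 2) * Real.sin β : ℝ);
        -(Real.sin (θ / 2) * Real.sin β : ℝ), star (W 0 0)] := by
    rw [matH_mul_matRz_mul_matH, matH_mul_matRz_mul_matH, neg_div, Real.cos_neg, Real.sin_neg, ha,
      hβ, hβ', matRz, h1, h2]
    generalize Real.cos (θ / 2) = C
    generalize Real.sin (θ / 2) = S
    generalize Real.cos (β / 2) = c at hcs ⊢
    generalize Real.sin (β / 2) = s at hcs ⊢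
    have hcs' : (s : ℂ) ^ 2 + (c : ℂ) ^ 2 = 1 := by exact_mod_cast hcs
    have hI := Complex.I_sq
    ext i j
    fin_cases i <;> fin_cases j <;> simp
    · linear_combination (C : ℂ) * hcs' + (-(s : ℂ) ^ 2 * (C + S * Complex.I)) * hI
    · linear_combination (-2 * (s : ℂ) * c * S) * hI
    · linear_combination (2 * (s : ℂ) * c * S) * hI
    · linear_combination (C : ℂ) * hcs' + (-(s : ℂ) ^ 2 * (C - S * Complex.I)) * hI
  have he : Complex.exp (Complex.I * α) =
      Complex.exp (Complex.I * α / 2) * Complex.exp (Complex.I * α / 2) := by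
    rw [← Complex.exp_add]; congr 1; ring
  have he' : star (Complex.exp (Complex.I * α)) =
      Complex.exp (-(Complex.I * α / 2)) * Complex.exp (-(Complex.I * α / 2)) := by
    rw [← Complex.exp_add, ← starRingEnd_apply, ← Complex.exp_conj]
    congr 1
    simp
    ring
  have hu : Complex.exp (Complex.I * α / 2) * Complex.exp (-(Complex.I * α / 2)) = 1 := by
    rw [← Complex.exp_add, add_neg_cancel, Complex.exp_zero]
  rw [show matRz (-α) * (matH * matRz β * matH) * matRz θ *
      ((matH * matRz (-β) * matH) * matRz (- -α)) = matRz (-α) *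
      (matH * matRz β * matH * matRz θ * (matH * matRz (-β) * matH)) * matRz (- -α) by
    simp only [mul_assoc], hmid, neg_neg]
  have hneg : matRz (-α) = !![Complex.exp (Complex.I * α / 2), 0;
      0, Complex.exp (-(Complex.I * α / 2))] := by
    simp [matRz, neg_div]
  rw [hneg, matRz]
  generalize Complex.exp (Complex.I * α / 2) = e at *
  generalize Complex.exp (-(Complex.I * α / 2)) = e' at *
  generalize Real.sin (θ / 2) * Real.sin β = r at *
  ext i j
  fin_cases i <;> fin_cases j <;> simp
  · linear_combination -W 0 0 * hu
  · rw [hb, he]; ring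
  · rw [h10, hb, star_mul', he']
    simp
    ring
  · rw [h11]
    simp only [Complex.star_def]
    linear_combination -(starRingEnd ℂ) (W 0 0) * hu

/-! ### Multi-controlled gates from sign oracles -/

/-- A sign `s` on the labels that changes with the qubit `t` precisely when `h` holds. -/
structure SignOracle (t : Fin k) (h : Basis k → Prop) (s : Basis k → ℂ) : Prop where
  sq : ∀ x, s x * s x = 1
  flip_on : ∀ x, h x → s (flip t x) = -s x
  flip_off : ∀ x, ¬ h x → s (flip t x) = s x

theorem realizable_basisChange (α β : ℝ) (t : Fin k) :
    Realizable (ctl t fun _ => matRz α * (matH * matRz β * matH)) 0 0 2 2 :=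
  (realizable_rz α t).ctl_mul
    (((realizable_hadamard t).ctl_mul (realizable_rz β t)).ctl_mul (realizable_hadamard t))

theorem realizable_basisChange' (α β : ℝ) (t : Fin k) :
    Realizable (ctl t fun _ => matH * matRz β * matH * matRz α) 0 0 2 2 :=
  (((realizable_hadamard t).ctl_mul (realizable_rz β t)).ctl_mul (realizable_hadamard t)).ctl_mul
    (realizable_rz α t)

theorem basisChange_mul (α β : ℝ) :
    matRz α * (matH * matRz β * matH) * (matH * matRz (-β) * matH * matRz (-α)) = 1 := by
  rw [show matRz α * (matH * matRz β * matH) * (matH * matRz (-β) * matH * matRz (-α)) =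
    matRz α * (matH * (matRz β * (matH * matH) * matRz (-β)) * matH) * matRz (-α) by
      simp only [mul_assoc], matH_mul_self, mul_one, matRz_mul_neg, mul_one, matH_mul_self, mul_one,
    matRz_mul_neg]

/-- A multi-controlled `R_z` gate turns into any multi-controlled special unitary gate. -/
theorem realizable_mcGate_of_matRz {C : Finset (Fin k)} {t : Fin k} (ht : t ∉ C)
    {W : Matrix (Fin 2) (Fin 2) ℂ} (hW : W ∈ Matrix.specialUnitaryGroup (Fin 2) ℂ)
    {c τ η r : ℕ} (h : ∀ θ : ℝ, ∃ F, Realizable (ctl t F) c τ η r ∧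
      ∀ y, F y = if ∀ c ∈ C, y c = 1 then matRz θ else 1) :
    Realizable (mcGate C t W) c τ (η + 4) (r + 4) := by
  obtain ⟨α, β, θ, rfl⟩ := exists_conj_matRz hW
  obtain ⟨F, hF, hF'⟩ := h θ
  rw [mcGate_eq_ctl ht]
  refine Realizable.mono (A := ctl t _) ?_ (show 0 + c + 0 ≤ _ by omega)
    (show 0 + τ + 0 ≤ _ by omega) (show 2 + η + 2 ≤ _ by omega) (show 2 + r + 2 ≤ _ by omega)
  convert ((realizable_basisChange α β t).ctl_mul hF).ctl_mul
    (realizable_basisChange' (-α) (-β) t) using 3 with y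
  rw [hF']
  split_ifs
  · rfl
  · rw [mul_one, basisChange_mul]

theorem SignOracle.matrix_on {t : Fin k} {h : Basis k → Prop} {s : Basis k → ℂ}
    (hs : SignOracle t h s) {y : Basis k} (hy : h y) :
    !![s y, 0; 0, s (flip t y)] = s y • matZ := by
  rw [hs.flip_on y hy, matZ]
  simp

theorem SignOracle.matrix_off {t : Fin k} {h : Basis k → Prop} {s : Basis k → ℂ}
    (hs : SignOracle t h s) {y : Basis k} (hy : ¬ h y) :
    !![s y, 0; 0, s (flip t y)] = s y • (1 : Matrix (Fin 2) (Fin 2) ℂ) := by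
  rw [hs.flip_off y hy]
  simp [Matrix.one_fin_two]

/-- The block of a sign oracle in the tilted frame. -/
theorem tilted_block {t : Fin k} {P h : Basis k → Prop} {s : Basis k → ℂ}
    {o : Basis k → Matrix (Fin 2) (Fin 2) ℂ} (hs : SignOracle t h s) (ho : Tilts P o)
    (y : Basis k) : ∃ N, o y * !![s y, 0; 0, s (flip t y)] * o y = N ∧ N * N = 1 ∧
      (h y → P y → OffDiag N) ∧ (¬ P y → OnDiag N) ∧ (¬ h y → N = s y • 1) ∧
      (h y → N = s y • (o y * matZ * o y)) := by
  refine ⟨_, rfl, ?_, fun h1 h2 => ?_, fun h2 => ?_, fun h1 => ?_, fun h1 => ?_⟩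
  · have e : !![s y, 0; 0, s (flip t y)] * !![s y, 0; 0, s (flip t y)] = 1 := by
      simp [Matrix.one_fin_two, hs.sq]
    rw [show o y * !![s y, 0; 0, s (flip t y)] * o y * (o y * !![s y, 0; 0, s (flip t y)] * o y) =
      o y * (!![s y, 0; 0, s (flip t y)] * (o y * o y) * !![s y, 0; 0, s (flip t y)]) * o y by
        simp only [mul_assoc], ho.mul_self, mul_one, e, mul_one, ho.mul_self]
  · obtain ⟨h3, h4⟩ := ho.offDiag y h2
    rw [hs.matrix_on h1, Matrix.mul_smul, Matrix.smul_mul]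
    exact ⟨by rw [Matrix.smul_apply, h3, smul_zero], by rw [Matrix.smul_apply, h4, smul_zero]⟩
  · by_cases h1 : h y
    · obtain ⟨h3, h4⟩ := ho.onDiag y h2
      rw [hs.matrix_on h1, Matrix.mul_smul, Matrix.smul_mul]
      exact ⟨by rw [Matrix.smul_apply, h3, smul_zero], by rw [Matrix.smul_apply, h4, smul_zero]⟩
    · rw [hs.matrix_off h1, Matrix.mul_smul, Matrix.smul_mul, mul_one, ho.mul_self]
      simp [OnDiag]
  · rw [hs.matrix_off h1, Matrix.mul_smul, Matrix.smul_mul, mul_one, ho.mul_self]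
  · rw [hs.matrix_on h1, Matrix.mul_smul, Matrix.smul_mul]

theorem conj_matRz {N : Matrix (Fin 2) (Fin 2) ℂ} (h : N * N = 1) (a : ℝ) :
    (OffDiag N → N * matRz a * N = matRz (-a)) ∧ (OnDiag N → N * matRz a * N = matRz a) :=
  ⟨fun h' => by rw [h'.mul_matRz, mul_assoc, h, mul_one],
    fun h' => by rw [h'.mul_matRz, mul_assoc, h, mul_one]⟩

theorem onDiag_smul_one (z : ℂ) : OnDiag (z • 1) := by simp [OnDiag]

/-- Two calls to one sign oracle give a multi-controlled gate. -/
theorem realizable_mcGate_of_signOracle {C : Finset (Fin k)} {t : Fin k} (ht : t ∉ C)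
    {W : Matrix (Fin 2) (Fin 2) ℂ} (hW : W ∈ Matrix.specialUnitaryGroup (Fin 2) ℂ)
    {P h : Basis k → Prop} {s : Basis k → ℂ} {o : Basis k → Matrix (Fin 2) (Fin 2) ℂ}
    {c τ η c' τ' η' : ℕ} (hs : SignOracle t h s) (ho : Tilts P o)
    (hC : ∀ y, (∀ c ∈ C, y c = 1) ↔ h y ∧ P y)
    (hsr : Realizable (Matrix.diagonal s) c τ η 0) (hor : Realizable (ctl t o) c' τ' η' 0) :
    Realizable (mcGate C t W) (2 * c + 4 * c') (2 * τ + 4 * τ') (2 * η + 4 * η' + 4) 6 := by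
  refine realizable_mcGate_of_matRz (r := 2) ht hW fun θ => ?_
  rw [diagonal_eq_ctl t] at hsr
  have hN := (hor.ctl_mul hsr).ctl_mul hor
  refine ⟨_, (((hN.ctl_mul (realizable_rz (-(θ / 2)) t)).ctl_mul hN).ctl_mul
    (realizable_rz (θ / 2) t)).mono (by omega) (by omega) (by omega) (by omega), fun y => ?_⟩
  obtain ⟨N, e, h1, h2, h3, h4, h5⟩ := tilted_block hs ho y
  simp only [e]
  by_cases hy : h y ∧ P y
  -- Conjugation turns `matRz (-(θ/2))` into `matRz (θ/2)`, and the two half rotations add up.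
  · rw [if_pos ((hC y).2 hy), (conj_matRz h1 _).1 (h2 hy.1 hy.2), ← matRz_add]
    congr 1
    ring
  · rw [if_neg fun h' => hy ((hC y).1 h')]
    have : OnDiag N := by
      by_cases hP : P y
      · rw [h4 fun h' => hy ⟨h', hP⟩]
        exact onDiag_smul_one _
      · exact h3 hP
    rw [(conj_matRz h1 _).2 this, matRz_neg_mul]

/-- Two calls to each of two sign oracles give a gate controlled by both conditions. -/
theorem realizable_mcGate_of_signOracle_two {C : Finset (Fin k)} {t : Fin k} (ht : t ∉ C)
    {W : Matrix (Fin 2) (Fin 2) ℂ} (hW : W ∈ Matrix.specialUnitaryGroup (Fin 2) ℂ)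
    {P h₁ h₂ : Basis k → Prop} {s₁ s₂ : Basis k → ℂ} {o : Basis k → Matrix (Fin 2) (Fin 2) ℂ}
    {c₁ τ₁ η₁ c₂ τ₂ η₂ c' τ' η' : ℕ} (hs₁ : SignOracle t h₁ s₁) (hs₂ : SignOracle t h₂ s₂)
    (ho : Tilts P o) (hC : ∀ y, (∀ c ∈ C, y c = 1) ↔ h₁ y ∧ h₂ y ∧ P y)
    (hr₁ : Realizable (Matrix.diagonal s₁) c₁ τ₁ η₁ 0)
    (hr₂ : Realizable (Matrix.diagonal s₂) c₂ τ₂ η₂ 0) (hor : Realizable (ctl t o) c' τ' η' 0) :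
    Realizable (mcGate C t W) (2 * (c₁ + c₂) + 8 * c') (2 * (τ₁ + τ₂) + 8 * τ')
      (2 * (η₁ + η₂) + 8 * η' + 4) 8 := by
  refine realizable_mcGate_of_matRz (r := 4) ht hW fun θ => ?_
  rw [diagonal_eq_ctl t] at hr₁ hr₂
  have hN₁ := (hor.ctl_mul hr₁).ctl_mul hor
  have hN₂ := (hor.ctl_mul hr₂).ctl_mul hor
  have hh := ((hN₁.ctl_mul (realizable_rz (-(θ / 4)) t)).ctl_mul hN₂).ctl_mul
    (realizable_rz (θ / 4) t)
  refine ⟨_, (hh.ctl_mul hh).mono (by omega) (by omega) (by omega) (by omega), fun y => ?_⟩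
  obtain ⟨N, e, h1, h2, h3, h4, h5⟩ := tilted_block hs₁ ho y
  obtain ⟨N', e', h1', h2', h3', h4', h5'⟩ := tilted_block hs₂ ho y
  simp only [e, e']
  -- Both are scalar multiples of the same `o y * matZ * o y`, or one of them is scalar. This needs
  -- the same tilt `o` for both oracles.
  have hcomm : Commute N N' := by
    by_cases hh₁ : h₁ y
    · by_cases hh₂ : h₂ y
      · rw [h5 hh₁, h5' hh₂]
        exact ((Commute.refl _).smul_left _).smul_right _
      · rw [h4' hh₂]
        exact (Commute.one_right _).smul_right _
    · rw [h4 hh₁]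
      exact (Commute.one_left _).smul_left _
  have hsq : N * N' * (N * N') = 1 := by
    rw [hcomm.symm.mul_mul_mul_comm, h1, h1', one_mul]
  by_cases hy : h₁ y ∧ h₂ y ∧ P y
  · have hN := h2 hy.1 hy.2.2
    have hN' := h2' hy.2.1 hy.2.2
    have e1 : N * matRz (-(θ / 4)) * N' * matRz (θ / 4) = N * N' * matRz (θ / 2) := by
      rw [mul_assoc N, ← hN'.mul_matRz, ← mul_assoc, mul_assoc (N * N'), ← matRz_add]
      congr 2
      ring
    -- A product of two off-diagonal matrices is diagonal, so it commutes with rotations and then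
    -- squares away.
    have e2 : N * N' * matRz (θ / 2) = matRz (θ / 2) * (N * N') := by
      rw [mul_assoc, hN'.mul_matRz, ← mul_assoc, hN.mul_matRz, neg_neg, mul_assoc]
    rw [if_pos ((hC y).2 hy), e1]
    nth_rw 1 [e2]
    rw [mul_assoc, ← mul_assoc (N * N'), hsq, one_mul, ← matRz_add, add_halves]
  · rw [if_neg fun h' => hy ((hC y).1 h')]
    have hd : OnDiag N ∨ OnDiag N' := by
      by_cases hP : P y
      · by_cases hh₁ : h₁ y
        · right
          rw [h4' fun hh₂ => hy ⟨hh₁, hh₂, hP⟩]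
          exact onDiag_smul_one _
        · left
          rw [h4 hh₁]
          exact onDiag_smul_one _
      · exact Or.inl (h3 hP)
    rcases hd with hd | hd
    · rw [hd.mul_matRz, show ∀ A B : Matrix (Fin 2) (Fin 2) ℂ,
        A * N * N' * B * (A * N * N' * B) = A * (N * N' * (B * A) * (N * N')) * B by
          intros; simp only [mul_assoc], matRz_mul_neg, mul_one, hsq, mul_one, matRz_neg_mul]
    · have e1 : N * matRz (-(θ / 4)) * N' * matRz (θ / 4) = N * N' := by
        rw [mul_assoc N, ← hd.mul_matRz, ← mul_assoc, mul_assoc (N * N'), matRz_neg_mul, mul_one]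
      rw [e1, hsq]

/-! ### Placing the ladders on the line -/

/-- The positions `p 0 = t, …, p L` walk along the line away from `t`. -/
structure IsWalk (t : Fin k) (p : ℕ → Fin k) (L : ℕ) : Prop where
  zero : p 0 = t
  adj : ∀ i < L, Adj (p i) (p (i + 1))
  inj : ∀ i j, i ≤ L → j ≤ L → p i = p j → i = j

theorem IsWalk.mono {t : Fin k} {p : ℕ → Fin k} {L m : ℕ} (hp : IsWalk t p L) (h : m ≤ L) :
    IsWalk t p m :=
  ⟨hp.zero, fun i hi => hp.adj i (hi.trans_le h),
    fun i j hi hj => hp.inj i j (hi.trans h) (hj.trans h)⟩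

theorem isWalk_left (t : Fin k) :
    IsWalk t (fun i => ⟨t - i, (Nat.sub_le _ _).trans_lt t.2⟩) t where
  zero := by simp
  adj i hi := Or.inr (show (t : ℕ) - (i + 1) + 1 = t - i by omega)
  inj i j hi hj h := by
    have : (t : ℕ) - i = t - j := congrArg Fin.val h
    omega

theorem isWalk_right (t : Fin k) :
    IsWalk t (fun i => if h : (t : ℕ) + i < k then ⟨t + i, h⟩ else t) (k - 1 - t) where
  zero := by simp
  adj i hi := by
    rw [dif_pos (by omega), dif_pos (by omega)]
    exact Or.inl rfl
  inj i j hi hj h := by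
    have := t.2
    rw [dif_pos (by omega), dif_pos (by omega)] at h
    have : (t : ℕ) + i = t + j := congrArg Fin.val h
    omega

theorem card_eq_sum_walk {t : Fin k} {p : ℕ → Fin k} {m : ℕ} {D : Finset (Fin k)}
    (hp : IsWalk t p m) (hD : ∀ c ∈ D, ∃ i, 1 ≤ i ∧ i ≤ m ∧ p i = c) :
    D.card = ∑ i ∈ Finset.Ico 1 (m + 1), if p i ∈ D then 1 else 0 := by
  rw [← Finset.card_filter, ← Finset.card_image_of_injOn (f := p)]
  · congr 1
    ext c
    simp only [Finset.mem_image, Finset.mem_filter, Finset.mem_Ico]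
    constructor
    · intro hc
      obtain ⟨i, h1, h2, rfl⟩ := hD c hc
      exact ⟨i, ⟨⟨h1, by omega⟩, hc⟩, rfl⟩
    · rintro ⟨i, ⟨-, h⟩, rfl⟩
      exact h
  · intro i hi j hj h
    simp only [Finset.coe_filter, Finset.mem_Ico, Set.mem_ofPred_eq] at hi hj
    exact hp.inj i j (by omega) (by omega) h

theorem ChainPhase.signOracle {t : Fin k} {p : ℕ → Fin k} {m : ℕ} {D : Finset (Fin k)}
    {s : Basis k → ℂ} (hs : ChainPhase p m D s) (h : p 0 = t) :
    SignOracle t (ChainOn p m D) s :=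
  ⟨hs.sq, h ▸ hs.flip_on, h ▸ hs.flip_off⟩

/-- A sign oracle for all controls `D` on one side of `t`, except possibly the neighbour of `t`. -/
theorem exists_signOracle {t : Fin k} {p : ℕ → Fin k} {L : ℕ} {D : Finset (Fin k)}
    (hp : IsWalk t p L) (hne : D.Nonempty) (hD : ∀ c ∈ D, ∃ i, 1 ≤ i ∧ i ≤ L ∧ p i = c) :
    ∃ E ⊆ D, ∃ h s c τ η, (∀ e ∈ E, Adj e t) ∧ E.card ≤ 1 ∧ SignOracle t h s ∧
      (∀ y, (∀ c ∈ D, y c = 1) ↔ h y ∧ ∀ e ∈ E, y e = 1) ∧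
      Realizable (Matrix.diagonal s) c τ η 0 ∧ c + 4 * E.card + 5 ≤ 4 * D.card + 2 * L ∧
      τ + 8 + 8 * E.card ≤ 8 * D.card ∧ η + 2 + 4 * E.card ≤ 4 * D.card := by
  -- `p m` is the control furthest from `t`, where the ladder must end.
  obtain ⟨m, hm1, hmL, hmD, hDm⟩ : ∃ m, 1 ≤ m ∧ m ≤ L ∧ p m ∈ D ∧
      ∀ c ∈ D, ∃ i, 1 ≤ i ∧ i ≤ m ∧ p i = c := by
    choose! f hf1 hfL hf using hD
    obtain ⟨c, hc, hmax⟩ := D.exists_max_image f hne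
    exact ⟨f c, hf1 c hc, hfL c hc, by rwa [hf c hc], fun d hd => ⟨f d, hf1 d hd, hmax d hd, hf d hd⟩⟩
  have hpm := hp.mono hmL
  have hcard := card_eq_sum_walk hpm hDm
  obtain ⟨s, hs, hr⟩ := exists_chainPhase D m hm1 p hpm.adj hpm.inj
  have hr := hr _ rfl
  rw [Finset.sum_Ico_succ_top hm1, if_pos hmD] at hcard
  obtain rfl | hm2 := eq_or_lt_of_le hm1
  · refine ⟨∅, by simp, _, s, _, _, _, by simp, by simp, hs.signOracle hp.zero, fun y => ?_, hr, ?_⟩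
    · simp only [Finset.notMem_empty, false_imp_iff, implies_true, and_true]
      constructor
      · exact fun h => ⟨h _ hmD, fun i h1 h2 => by omega⟩
      · intro h c hc
        obtain ⟨i, h1, h2, rfl⟩ := hDm c hc
        rw [show i = 1 by omega]
        exact h.1
    · simp only [Finset.Ico_self, Finset.sum_empty, zero_add] at hcard
      rw [Finset.Ico_eq_empty (by omega), Finset.sum_empty, Finset.card_empty]
      omega
  · rw [Finset.sum_eq_sum_Ico_succ_bot hm2, one_add_one_eq_two] at hcard
    -- The ladder skips `p 1`, so if that qubit is a control it is left to the tilt.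
    refine ⟨D.filter (· = p 1), Finset.filter_subset _ _, _, s, _, _, _, ?_, ?_,
      hs.signOracle hp.zero, fun y => ?_, hr, ?_⟩
    · intro e he
      rw [(Finset.mem_filter.1 he).2, ← hp.zero]
      exact (hpm.adj 0 (by omega)).symm
    · rw [Finset.filter_eq']
      split_ifs <;> simp
    · constructor
      · exact fun h => ⟨⟨h _ hmD, fun i _ _ hi => h _ hi⟩,
          fun e he => h e (Finset.mem_filter.1 he).1⟩
      · rintro ⟨⟨h1, h2⟩, h3⟩ c hc
        obtain ⟨i, hi1, him, rfl⟩ := hDm c hc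
        obtain rfl | hi2 := eq_or_lt_of_le hi1
        · exact h3 _ (Finset.mem_filter.2 ⟨hc, rfl⟩)
        · obtain rfl | him' := eq_or_lt_of_le him
          · exact h1
          · exact h2 i hi2 him' hc
    · have : (D.filter (· = p 1)).card = if p 1 ∈ D then 1 else 0 := by
        rw [Finset.filter_eq']
        split_ifs <;> simp
      rw [this]
      omega

theorem Realizable.implementsWithin {A : Operator k} {c τ η r : ℕ} (h : Realizable A c τ η r)
    {c' τ' η' r' : ℤ} (hc : (c : ℤ) ≤ c') (hτ : (τ : ℤ) ≤ τ') (hη : (η : ℤ) ≤ η')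
    (hr : (r : ℤ) ≤ r') : ∃ l : Circuit k, l.ImplementsWithin A c' τ' η' r' := by
  obtain ⟨l, h, h1, h2, h3, h4⟩ := h
  exact ⟨l, h, by omega, by omega, by omega, by omega⟩

/-- The case in which all controls but at most one neighbour of the target lie on one side. -/
theorem exists_circuit_of_walk {t : Fin k} {p : ℕ → Fin k} {L : ℕ} {C D : Finset (Fin k)}
    (ht : t ∉ C) (hp : IsWalk t p L) (hL : L + 1 ≤ k) (hDC : D ⊆ C) (hne : D.Nonempty)
    (hD : ∀ c ∈ D, ∃ i, 1 ≤ i ∧ i ≤ L ∧ p i = c) (hadj : ∀ c ∈ C \ D, Adj c t)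
    (hcard : (C \ D).card ≤ 1)
    {W : Matrix (Fin 2) (Fin 2) ℂ} (hW : W ∈ Matrix.specialUnitaryGroup (Fin 2) ℂ) :
    ∃ l : Circuit k, l.ImplementsWithin (mcGate C t W)
      (4 * (k : ℤ) + 8 * (C.card : ℤ) - 14) (16 * (C.card : ℤ) - 16)
      (8 * (C.card : ℤ) + 12) 6 := by
  obtain ⟨E, hED, h, s, c, τ, η, hE, hE1, hs, hDy, hr, hc, hτ, hη⟩ := exists_signOracle hp hne hD
  have hdisj : Disjoint E (C \ D) := Finset.disjoint_sdiff.mono_left hED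
  have hEc := Finset.card_union_of_disjoint hdisj
  have hCc := Finset.card_sdiff_add_card_eq_card hDC
  obtain ⟨o, c', τ', η', hor, ho, hcases⟩ := exists_tilts (t := t) (E := E ∪ C \ D)
    (fun e he => (Finset.mem_union.1 he).elim (hE e) (hadj e)) (by omega)
  -- The CNOT and `T` bounds are tightest when the tilt has no controls, so that it is a bare `H`.
  refine (realizable_mcGate_of_signOracle ht hW hs ho (fun y => ?_) hr hor).implementsWithin
    (by omega) (by omega) (by omega) (by norm_num)
  rw [Finset.forall_mem_union, ← and_assoc, ← hDy, ← Finset.forall_mem_union,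
    Finset.union_sdiff_of_subset hDC]

/-- The case in which there are controls on both sides of the target. -/
theorem exists_circuit_of_walks {t : Fin k} {p₁ p₂ : ℕ → Fin k} {L₁ L₂ : ℕ}
    {C D₁ D₂ : Finset (Fin k)} (ht : t ∉ C) (hp₁ : IsWalk t p₁ L₁) (hp₂ : IsWalk t p₂ L₂)
    (hL : L₁ + L₂ + 1 ≤ k) (hC : D₁ ∪ D₂ = C) (hdisj : Disjoint D₁ D₂)
    (hne₁ : D₁.Nonempty) (hne₂ : D₂.Nonempty)
    (hD₁ : ∀ c ∈ D₁, ∃ i, 1 ≤ i ∧ i ≤ L₁ ∧ p₁ i = c)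
    (hD₂ : ∀ c ∈ D₂, ∃ i, 1 ≤ i ∧ i ≤ L₂ ∧ p₂ i = c)
    {W : Matrix (Fin 2) (Fin 2) ℂ} (hW : W ∈ Matrix.specialUnitaryGroup (Fin 2) ℂ) :
    ∃ l : Circuit k, l.ImplementsWithin (mcGate C t W)
      (4 * (k : ℤ) + 8 * (C.card : ℤ) - 14) (16 * (C.card : ℤ) - 16)
      (8 * (C.card : ℤ) + 12) 8 := by
  obtain ⟨E₁, hED₁, h₁, s₁, c₁, τ₁, η₁, hE₁, hE1₁, hs₁, hDy₁, hr₁, hc₁, hτ₁, hη₁⟩ :=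
    exists_signOracle hp₁ hne₁ hD₁
  obtain ⟨E₂, hED₂, h₂, s₂, c₂, τ₂, η₂, hE₂, hE1₂, hs₂, hDy₂, hr₂, hc₂, hτ₂, hη₂⟩ :=
    exists_signOracle hp₂ hne₂ hD₂
  have hEc := Finset.card_union_of_disjoint (hdisj.mono hED₁ hED₂)
  have hCc := Finset.card_union_of_disjoint hdisj
  rw [hC] at hCc
  obtain ⟨o, c', τ', η', hor, ho, hcases⟩ := exists_tilts (t := t) (E := E₁ ∪ E₂)
    (fun e he => (Finset.mem_union.1 he).elim (hE₁ e) (hE₂ e)) (by omega)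
  -- The `T` and `H` bounds are tightest when both neighbours of `t` are left to the tilt, which
  -- occurs eight times.
  refine (realizable_mcGate_of_signOracle_two ht hW hs₁ hs₂ ho (fun y => ?_) hr₁ hr₂
    hor).implementsWithin (by omega) (by omega) (by omega) (by norm_num)
  rw [← hC, Finset.forall_mem_union, Finset.forall_mem_union, hDy₁, hDy₂]
  tauto

end LNN

/-! ### Case split on the sides occupied by controls -/

theorem mainTheorem2 (k n : ℕ) (hn : 1 ≤ n) (hk : n + 1 ≤ k)
    (t : Fin k) (C : Finset (Fin k)) (htC : t ∉ C) (hC : C.card = n)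
    (W : Matrix (Fin 2) (Fin 2) ℂ) (hW : W ∈ Matrix.specialUnitaryGroup (Fin 2) ℂ) :
    (∃ l : LNN.Circuit k, LNN.Circuit.ImplementsWithin l (LNN.mcGate C t W)
      (4 * (k : ℤ) + 8 * (n : ℤ) - 14) (16 * (n : ℤ) - 16) (8 * (n : ℤ) + 12) 8) ∧
    ((∀ c ∈ C, (c : ℕ) ≤ (t : ℕ) + 1) →
      ∃ l : LNN.Circuit k, LNN.Circuit.ImplementsWithin l (LNN.mcGate C t W)
        (4 * (k : ℤ) + 8 * (n : ℤ) - 14) (16 * (n : ℤ) - 16) (8 * (n : ℤ) + 12) 6) := by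
  classical
  subst hC
  have htk := t.2
  have hl := LNN.isWalk_left t
  have hr := LNN.isWalk_right t
  set D₁ := C.filter (· < t)
  set D₂ := C.filter (t < ·)
  have hdisj : Disjoint D₁ D₂ :=
    Finset.disjoint_filter.2 fun c _ h h' => (h.trans h').false
  have hunion : D₁ ∪ D₂ = C := by
    rw [← Finset.filter_or]
    exact Finset.filter_true_of_mem fun c hc => lt_or_gt_of_ne (by rintro rfl; exact htC hc)
  have hD₁ : ∀ c ∈ D₁, ∃ i, 1 ≤ i ∧ i ≤ (t : ℕ) ∧
      (⟨t - i, (Nat.sub_le _ _).trans_lt t.2⟩ : Fin k) = c := fun c hc => by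
    have : (c : ℕ) < t := (Finset.mem_filter.1 hc).2
    exact ⟨t - c, by omega, by omega, Fin.ext (show (t : ℕ) - (t - c) = c by omega)⟩
  have hD₂ : ∀ c ∈ D₂, ∃ i, 1 ≤ i ∧ i ≤ k - 1 - t ∧
      (if h : (t : ℕ) + i < k then ⟨t + i, h⟩ else t : Fin k) = c := fun c hc => by
    have h1 : (t : ℕ) < c := (Finset.mem_filter.1 hc).2
    have h2 := c.2
    refine ⟨c - t, by omega, by omega, ?_⟩
    rw [dif_pos (by omega)]
    exact Fin.ext (show (t : ℕ) + (c - t) = c by omega)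
  have hright : D₁ = ∅ → ∃ l : LNN.Circuit k, LNN.Circuit.ImplementsWithin l (LNN.mcGate C t W)
      (4 * (k : ℤ) + 8 * (C.card : ℤ) - 14) (16 * (C.card : ℤ) - 16)
      (8 * (C.card : ℤ) + 12) 6 := fun h => by
    have h2 : D₂ = C := by rw [← hunion, h, Finset.empty_union]
    refine LNN.exists_circuit_of_walk htC hr (by omega) h2.le ?_ hD₂ ?_ ?_ hW
    · rw [h2, ← Finset.card_pos]
      omega
    all_goals simp [h2]
  -- The only possible control above `t` is `t + 1`, a neighbour that the tilt absorbs, so one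
  -- ladder to the left suffices.
  have hleft : (∀ c ∈ C, (c : ℕ) ≤ (t : ℕ) + 1) →
      ∃ l : LNN.Circuit k, LNN.Circuit.ImplementsWithin l (LNN.mcGate C t W)
        (4 * (k : ℤ) + 8 * (C.card : ℤ) - 14) (16 * (C.card : ℤ) - 16)
        (8 * (C.card : ℤ) + 12) 6 := fun h => by
    obtain h1 | h1 := D₁.eq_empty_or_nonempty
    · exact hright h1
    have hsd : C \ D₁ = D₂ := by rw [← hunion, Finset.union_sdiff_cancel_left hdisj]
    have hval : ∀ c ∈ D₂, (c : ℕ) = t + 1 := fun c hc => by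
      have h2 : (t : ℕ) < c := (Finset.mem_filter.1 hc).2
      have := h c (Finset.mem_filter.1 hc).1
      omega
    refine LNN.exists_circuit_of_walk htC hl (by omega) (Finset.filter_subset _ _) h1 hD₁ ?_ ?_ hW
    · rw [hsd]
      exact fun c hc => Or.inr (hval c hc).symm
    · rw [hsd]
      exact Finset.card_le_one.2 fun a ha b hb => Fin.ext ((hval a ha).trans (hval b hb).symm)
  have hweak : (∃ l : LNN.Circuit k, LNN.Circuit.ImplementsWithin l (LNN.mcGate C t W)
      (4 * (k : ℤ) + 8 * (C.card : ℤ) - 14) (16 * (C.card : ℤ) - 16)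
      (8 * (C.card : ℤ) + 12) 6) → ∃ l : LNN.Circuit k, LNN.Circuit.ImplementsWithin l
      (LNN.mcGate C t W) (4 * (k : ℤ) + 8 * (C.card : ℤ) - 14) (16 * (C.card : ℤ) - 16)
      (8 * (C.card : ℤ) + 12) 8 := fun ⟨l, h0, h1, h2, h3, h4⟩ =>
    ⟨l, h0, h1, h2, h3, h4.trans (by norm_num)⟩
  refine ⟨?_, hleft⟩
  obtain h1 | h1 := D₁.eq_empty_or_nonempty
  · exact hweak (hright h1)
  obtain h2 | h2 := D₂.eq_empty_or_nonempty
  · refine hweak (hleft fun c hc => ?_)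
    rw [← hunion, h2, Finset.union_empty] at hc
    have : (c : ℕ) < t := (Finset.mem_filter.1 hc).2
    omega
  · exact LNN.exists_circuit_of_walks htC hl hr (by omega) hunion hdisj h1 h2 hD₁ hD₂ hW
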